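/- Let $G=(V,E)$ be a finite simple graph (not necessarily connected) with maximum degree $\Delta(G)\le 4$. Then $a'(G)\le 7$. Here $a'(G)$, the acyclic chromatic index of $G$, is the minimum number $k$ of colors for which $G$ has an acyclic edge coloring with $k$ available colors, where an edge coloring $c:E\to\{1,\dots,k\}$ is called acyclic if it is proper ($c(e)\ne c(f)$ for any two distinct edges $e,f$ sharing an endpoint) and $G$ contains no bichromatic cycle (for any two colors, the subgraph formed by the edges with these colors contains no cycle). -/

import Mathlib

namespace SimpleGraph

/-- An edge coloring of `G` with colors in `K` (a map from the edge set to `K`) is proper if any two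
distinct edges that share an endpoint get different colors. -/
def EdgeLabeling.IsProper {V K : Type*} {G : SimpleGraph V} (c : G.EdgeLabeling K) : Prop :=
  ∀ e f : G.edgeSet, G.lineGraph.Adj e f → c e ≠ c f

/-- A proper edge coloring is acyclic if there is no bichromatic cycle: for any two colors `a`, `b`
the subgraph formed by the edges colored `a` or `b` contains no cycle. -/
def EdgeLabeling.IsAcyclicColoring {V K : Type*} {G : SimpleGraph V} (c : G.EdgeLabeling K) :
    Prop :=
  c.IsProper ∧ ∀ a b : K, (c.labelGraph a ⊔ c.labelGraph b).IsAcyclic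

/-- `G` has an acyclic edge coloring with colors from a set of `k` colors. -/
def AcyclicallyEdgeColorable {V : Type*} (G : SimpleGraph V) (k : ℕ) : Prop :=
  ∃ c : G.EdgeLabeling (Fin k), c.IsAcyclicColoring

/-- The acyclic chromatic index `a'(G)`: the minimum number of colors in an acyclic edge coloring of
`G` (and `⊤` if no finite number of colors suffices). -/
noncomputable def acyclicChromaticIndex {V : Type*} (G : SimpleGraph V) : ℕ∞ :=
  ⨅ k ∈ {k : ℕ | G.AcyclicallyEdgeColorable k}, (k : ℕ∞)

end SimpleGraph

/-!
The graph is colored one vertex at a time: remove a vertex `x`, color the rest acyclically with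
seven colors, and color the at most four edges `x yᵢ` last. Let `Fᵢ` be the set of colors at `yᵢ`
before that step; it has at most three elements and is padded to exactly three. If the edges
`x yᵢ` get distinct colors `cᵢ ∉ Fᵢ`, the only bichromatic cycles that can arise pass through `x`
along some `yᵢ x yⱼ` and return from `yᵢ` to `yⱼ` along a path in the colors `cᵢ`, `cⱼ`; this
forces `cᵢ ∈ Fⱼ` and `cⱼ ∈ Fᵢ`. Two color classes together have maximum degree two, so a path in
the colors `a`, `b` from `yᵢ`, where `a` is missing, reaches at most one `yⱼ` where `b` is missing.

What remains is a statement about four `3`-subsets of a set of seven colors. Up to renaming colors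
there are 577 cases (`allResolved_eq_true`). In most of them a choice of the `cᵢ` exists for which
no path can be an obstacle. In others two choices are obstructed by two paths which cannot both
exist. In the remaining ones exactly one color `f` occurs in no `Fᵢ`, and, unless some choice
works, there is a color `b` in `Fᵢ` and in another `Fⱼ`, and a set `Fₗ` disjoint from `Fᵢ`, such
that the edge `yᵢ z` of color `b` continues at `z` in every color of `Fₗ`. Then `z` sees exactly
`b` and the colors of `Fₗ`, so `yᵢ z` can be recolored to `f` without creating a bichromatic cycle
(`IsAcyclicDecomposition.recolor`), after which every color occurs in some `Fⱼ` and the third case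
is excluded.

Colorings are handled as decompositions of the graph into matchings, one for each color, any two of
which have an acyclic union; bichromatic paths then become reachability in such a union.
-/

namespace SimpleGraph

/-! ### The finite check on colors around a vertex -/

/-- The seven colors. -/
def colorList : List (Fin 7) := [0, 1, 2, 3, 4, 5, 6]

/-- The positions of the at most four neighbors of a vertex. -/
def indexList : List (Fin 4) := [0, 1, 2, 3]

/-- Search for colors `c₀, c₁, c₂, c₃` with `P i cᵢ` for all `i` and `Q i j cᵢ cⱼ` for all
`i < j`, pruning as soon as a condition fails. -/
def searchColors (P : Fin 4 → Fin 7 → Bool) (Q : Fin 4 → Fin 4 → Fin 7 → Fin 7 → Bool) : Bool :=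
  colorList.any fun c₀ => P 0 c₀ &&
  colorList.any fun c₁ => P 1 c₁ && Q 0 1 c₀ c₁ &&
  colorList.any fun c₂ => P 2 c₂ && Q 0 2 c₀ c₂ && Q 1 2 c₁ c₂ &&
  colorList.any fun c₃ => P 3 c₃ && Q 0 3 c₀ c₃ && Q 1 3 c₁ c₃ && Q 2 3 c₂ c₃

/-- Here `used a i` says that the color `a` is taken at the `i`-th neighbor. The search is for
distinct colors `cᵢ`, each free at the `i`-th neighbor, such that for any two neighbors `i`, `j`
with `cᵢ` taken at `j` and `cⱼ` taken at `i` the obstacle `(i, j, cᵢ, cⱼ)` is tolerated by `T`, in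
one of its two orientations. The predicate `P` restricts the candidates; it only speeds up the
search. -/
def starColorable (used : Fin 7 → Fin 4 → Bool) (P : Fin 4 → Fin 7 → Bool)
    (T : Fin 4 → Fin 4 → Fin 7 → Fin 7 → Bool) : Bool :=
  searchColors (fun i a => !used a i && P i a) fun i j a b =>
    !(a == b) && (!(used a j && used b i) || T i j a b || T j i b a)

/-- The tolerance for the single obstacle `(i, j, a, b)`. -/
def isPair (i j : Fin 4) (a b : Fin 7) (i' j' : Fin 4) (a' b' : Fin 7) : Bool :=
  i == i' && j == j' && a == a' && b == b'

/-- The restriction of the search to color `a` at position `i`. -/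
def pin (i : Fin 4) (a : Fin 7) (i' : Fin 4) (a' : Fin 7) : Bool := !(i == i') || a == a'

/-- Two choices of colors, each with a single obstacle, where the obstacles are paths in the same
colors `a`, `b` from `i` to two different ends `j`, `k`. As only one of the paths exists, one of the
choices is unobstructed. -/
def clash (used : Fin 7 → Fin 4 → Bool) : Bool :=
  indexList.any fun i => colorList.any fun a => !used a i && colorList.any fun b => used b i &&
  indexList.any fun j => !(i == j) && used a j && !used b j &&
  (starColorable used (fun i' a' => pin i a i' a' && pin j b i' a') (isPair i j a b)) &&
  indexList.any fun k => !(i == k) && !(j == k) && used a k && !used b k &&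
  (starColorable used (fun i' a' => pin i a i' a' && pin k b i' a') (isPair i k a b))

/-- If no choice of colors is unobstructed, there is a path in the colors `a`, `b` from `i`, missing
`a`, to an end missing `b`. One choice is obstructed only by `(i, j, a, b)` and `(i, k, a, b')`, the
other only by `(i, j, a, b')` and `(i, k, a, b)`, and paths in the colors `a`, `b'` from `i` cannot
end both in `j` and in `k`. For `b = b'` and `j = k` this is a choice with a single obstacle. -/
def forced (used : Fin 7 → Fin 4 → Bool) (i : Fin 4) (a b : Fin 7) : Bool :=
  indexList.any fun j => !(i == j) && !used b j &&
  indexList.any fun k => !(i == k) && !used b k &&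
  colorList.any fun b' => (b == b' || (!(j == k) && !used b' j && !used b' k)) &&
  (starColorable used (fun i' a' => pin i a i' a' && pin j b i' a' && pin k b' i' a')
    fun i' j' a' b'' => isPair i j a b i' j' a' b'' || isPair i k a b' i' j' a' b'') &&
  (starColorable used (fun i' a' => pin i a i' a' && pin j b' i' a' && pin k b i' a')
    fun i' j' a' b'' => isPair i j a b' i' j' a' b'' || isPair i k a b i' j' a' b'')

/-- There is exactly one color `e` free everywhere, and a color `b` taken at `i` and elsewhere, such
that every color `a` taken at some `l` is free at `i` and forced to occur on a path from `i` that
starts with `b`. Such an edge of color `b` can be recolored to `e`. -/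
def stuck (used : Fin 7 → Fin 4 → Bool) : Bool :=
  colorList.any fun e => (indexList.all fun i => !used e i) &&
  (colorList.all fun e' => e' == e || indexList.any fun i => used e' i) &&
  indexList.any fun i => colorList.any fun b => used b i &&
  (indexList.any fun j => !(i == j) && used b j) &&
  indexList.any fun l => colorList.all fun a => !used a l || (!used a i && forced used i a b)

/-- One of the three ways of dealing with a distribution of colors at the four neighbors. -/
def resolved (used : Fin 7 → Fin 4 → Bool) : Bool :=
  starColorable used (fun _ _ => true) (fun _ _ _ _ => false) || clash used || stuck used

/-- The sums of distinct powers `16 ^ 0`, `16 ^ 1`, `16 ^ 2` that are at least `m`, as codes for the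
subsets of the first three neighbors. -/
def upFrom (m : ℕ) : List ℕ :=
  [0x000, 0x001, 0x010, 0x011, 0x100, 0x101, 0x110, 0x111].filter (Nat.ble m)

/-- Every distribution of the seven colors with three colors at each neighbor is resolved. A color
is coded by the set of the neighbors where it is taken, in hexadecimal; in increasing order of the
codes, the three colors taken at the last neighbor, which add `0x1000`, come last. Three colors at
each of the other neighbors mean that the codes add up to `0x333`. -/
def allResolved : Bool :=
  (upFrom 0).all fun q₀ => (upFrom q₀).all fun q₁ => (upFrom q₁).all fun q₂ =>
  (upFrom q₂).all fun q₃ => !Nat.ble (q₀ + q₁ + q₂ + q₃) 0x333 ||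
  (upFrom 0).all fun q₄ => (upFrom q₄).all fun q₅ => (upFrom q₅).all fun q₆ =>
  !Nat.beq (q₀ + q₁ + q₂ + q₃ + q₄ + q₅ + q₆) 0x333 ||
  resolved fun a i =>
    ([q₀, q₁, q₂, q₃, q₄ + 0x1000, q₅ + 0x1000, q₆ + 0x1000].getD a 0).testBit (4 * i)

set_option maxRecDepth 100000 in
theorem allResolved_eq_true : allResolved = true := by
  decide +kernel

/-! ### Choosing the colors at a vertex -/

/-- The properties of bichromatic paths on which the choice of colors depends. `R i j a b` stands
for a path in the colors `a`, `b` between the `i`-th and the `j`-th neighbor, where `a` is meant to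
be free at `i` and `b` at `j`. A path between different neighbors leaves `i` in the color `b` if `a` is
free there, and ends at most once in a vertex where `b` is free. -/
structure PathRelation (used : Fin 7 → Fin 4 → Bool)
    (R : Fin 4 → Fin 4 → Fin 7 → Fin 7 → Prop) : Prop where
  symm : ∀ {i j a b}, R i j a b → R j i b a
  used_of : ∀ {i j a b}, i ≠ j → R i j a b → used a i = false → used b i = true
  unique : ∀ {i j k a b}, i ≠ j → i ≠ k → used a i = false → used b j = false →
    used b k = false → R i j a b → R i k a b → j = k

/-- Colors `c i` for the edges to the neighbors: distinct, free at the neighbors, and without a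
bichromatic path between two neighbors in the colors of their edges. -/
def IsStarColoring (used : Fin 7 → Fin 4 → Bool) (R : Fin 4 → Fin 4 → Fin 7 → Fin 7 → Prop)
    (c : Fin 4 → Fin 7) : Prop :=
  Function.Injective c ∧ (∀ i, used (c i) i = false) ∧ ∀ i j, i ≠ j → ¬R i j (c i) (c j)

/-- The form of `stuck` that speaks of actual paths: `e` is the only color free everywhere, `b` is
taken at `i` and elsewhere, and for every color `a` taken at `l` there is a path in the colors `a`,
`b` from `i`, missing `a`, to another neighbor missing `b`. -/
def IsStuck (used : Fin 7 → Fin 4 → Bool) (R : Fin 4 → Fin 4 → Fin 7 → Fin 7 → Prop) : Prop :=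
  ∃ e, (∀ i, used e i = false) ∧ (∀ e', e' ≠ e → ∃ i, used e' i = true) ∧
    ∃ i b, used b i = true ∧ (∃ j, j ≠ i ∧ used b j = true) ∧
      ∃ l, ∀ a, used a l = true → used a i = false ∧ ∃ j, i ≠ j ∧ used b j = false ∧ R i j a b

variable {used : Fin 7 → Fin 4 → Bool} {R : Fin 4 → Fin 4 → Fin 7 → Fin 7 → Prop}

theorem exists_isStarColoring {P : Fin 4 → Fin 7 → Bool} {T : Fin 4 → Fin 4 → Fin 7 → Fin 7 → Bool}
    (hR : PathRelation used R) (h : starColorable used P T = true)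
    (hT : ∀ i j a b, T i j a b = true → ¬R i j a b) : ∃ c, IsStarColoring used R c := by
  simp only [starColorable, searchColors, List.any_eq_true, Bool.and_eq_true,
    Bool.or_eq_true, Bool.not_eq_true', beq_eq_false_iff_ne] at h
  obtain ⟨c₀, -, ⟨u₀, -⟩, c₁, -, ⟨⟨u₁, -⟩, d₁, h₁⟩, c₂, -, ⟨⟨⟨u₂, -⟩, d₂, h₂⟩, d₃, h₃⟩,
    c₃, -, ⟨⟨⟨u₃, -⟩, d₄, h₄⟩, d₅, h₅⟩, d₆, h₆⟩ := h
  have key : ∀ {i j a b}, i ≠ j → used a i = false → used b j = false →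
      (((used a j && used b i) = false ∨ T i j a b = true) ∨ T j i b a = true) →
      ¬R i j a b ∧ ¬R j i b a := by
    intro i j a b hij ha hb h
    suffices hn : ¬R i j a b from ⟨hn, fun h' => hn (hR.symm h')⟩
    rintro hr
    rcases h with (h | h) | h
    · rw [hR.used_of hij.symm (hR.symm hr) hb, hR.used_of hij hr ha] at h
      cases h
    · exact hT _ _ _ _ h hr
    · exact hT _ _ _ _ h (hR.symm hr)
  have k₁ := key (by decide) u₀ u₁ h₁
  have k₂ := key (by decide) u₀ u₂ h₂
  have k₃ := key (by decide) u₁ u₂ h₃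
  have k₄ := key (by decide) u₀ u₃ h₄
  have k₅ := key (by decide) u₁ u₃ h₅
  have k₆ := key (by decide) u₂ u₃ h₆
  refine ⟨![c₀, c₁, c₂, c₃], ?_, ?_, ?_⟩
  · intro i j
    fin_cases i <;> fin_cases j <;> simp <;> grind
  · intro i
    fin_cases i <;> simpa
  · intro i j
    fin_cases i <;> fin_cases j <;> simp <;>
      first
        | exact k₁.1 | exact k₂.1 | exact k₃.1 | exact k₄.1 | exact k₅.1 | exact k₆.1
        | exact k₁.2 | exact k₂.2 | exact k₃.2 | exact k₄.2 | exact k₅.2 | exact k₆.2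

theorem isPair_eq_true {i j i' j' : Fin 4} {a b a' b' : Fin 7}
    (h : isPair i j a b i' j' a' b' = true) : i = i' ∧ j = j' ∧ a = a' ∧ b = b' := by
  simp only [isPair, Bool.and_eq_true, beq_iff_eq] at h
  tauto

theorem exists_isStarColoring_of_clash (hR : PathRelation used R) (h : clash used = true) :
    ∃ c, IsStarColoring used R c := by
  simp only [clash, List.any_eq_true, Bool.and_eq_true, Bool.not_eq_true',
    beq_eq_false_iff_ne] at h
  obtain ⟨i, -, a, -, ha, b, -, -, j, -, ⟨⟨⟨hij, -⟩, hbj⟩, hj⟩, k, -, ⟨⟨⟨hik, hjk⟩, -⟩, hbk⟩,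
    hk⟩ := h
  by_contra hc
  have hRj : R i j a b := by
    by_contra hn
    refine hc (exists_isStarColoring hR hj fun _ _ _ _ hp => ?_)
    obtain ⟨rfl, rfl, rfl, rfl⟩ := isPair_eq_true hp
    exact hn
  have hRk : R i k a b := by
    by_contra hn
    refine hc (exists_isStarColoring hR hk fun _ _ _ _ hp => ?_)
    obtain ⟨rfl, rfl, rfl, rfl⟩ := isPair_eq_true hp
    exact hn
  exact hjk (hR.unique hij hik ha hbj hbk hRj hRk)

theorem exists_rel_of_forced (hR : PathRelation used R) (hc : ¬∃ c, IsStarColoring used R c)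
    {i : Fin 4} {a b : Fin 7} (ha : used a i = false) (h : forced used i a b = true) :
    ∃ j, i ≠ j ∧ used b j = false ∧ R i j a b := by
  simp only [forced, List.any_eq_true, Bool.and_eq_true, Bool.or_eq_true, Bool.not_eq_true',
    beq_eq_false_iff_ne, beq_iff_eq] at h
  obtain ⟨j, -, ⟨hij, hbj⟩, k, -, ⟨hik, hbk⟩, b', -, ⟨hb', h₁⟩, h₂⟩ := h
  by_contra hn
  push Not at hn
  have hj := hn j hij hbj
  have hk := hn k hik hbk
  have h₁' : R i k a b' := by
    by_contra hn'
    refine hc (exists_isStarColoring hR h₁ fun _ _ _ _ hp => ?_)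
    rcases (Bool.or_eq_true _ _).mp hp with hp | hp <;>
      obtain ⟨rfl, rfl, rfl, rfl⟩ := isPair_eq_true hp <;> assumption
  have h₂' : R i j a b' := by
    by_contra hn'
    refine hc (exists_isStarColoring hR h₂ fun _ _ _ _ hp => ?_)
    rcases (Bool.or_eq_true _ _).mp hp with hp | hp <;>
      obtain ⟨rfl, rfl, rfl, rfl⟩ := isPair_eq_true hp <;> assumption
  rcases hb' with rfl | ⟨⟨hjk, hj'⟩, hk'⟩
  · exact hj h₂'
  · exact hjk (hR.unique hij hik ha hj' hk' h₂' h₁')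

theorem mem_colorList (a : Fin 7) : a ∈ colorList := by revert a; decide

theorem isStuck_of_stuck (hR : PathRelation used R) (hc : ¬∃ c, IsStarColoring used R c)
    (h : stuck used = true) : IsStuck used R := by
  simp only [stuck, List.any_eq_true, List.all_eq_true, Bool.and_eq_true, Bool.or_eq_true,
    Bool.not_eq_true', beq_eq_false_iff_ne, beq_iff_eq] at h
  obtain ⟨e, -, ⟨he, he'⟩, i, -, b, -, ⟨hb, j, -, hij, hbj⟩, l, -, hl⟩ := h
  refine ⟨e, fun i => he i (by revert i; decide), fun e' hne => ?_, i, b, hb, ⟨j, hij.symm, hbj⟩, l,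
    fun a ha => ?_⟩
  · obtain ⟨i, -, hi⟩ := (he' e' (mem_colorList _)).resolve_left hne
    exact ⟨i, hi⟩
  · have := (hl a (mem_colorList _)).resolve_left (by simp [ha])
    exact ⟨this.1, exists_rel_of_forced hR hc this.1 this.2⟩

theorem exists_or_isStuck_of_resolved (hR : PathRelation used R) (h : resolved used = true) :
    (∃ c, IsStarColoring used R c) ∨ IsStuck used R := by
  by_contra! hn
  simp only [resolved, Bool.or_eq_true] at h
  rcases h with (h | h) | h
  · exact not_exists.mpr hn.1 (exists_isStarColoring hR h (by simp))
  · exact not_exists.mpr hn.1 (exists_isStarColoring_of_clash hR h)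
  · exact hn.2 (isStuck_of_stuck hR (not_exists.mpr hn.1) h)

/-- The set of neighbors `u` as the sum of the powers `16 ^ i`, so that up to fifteen sets can be
added without carry. -/
def code (u : Fin 4 → Bool) : ℕ := ∑ i, if u i then 16 ^ (i : ℕ) else 0

theorem code_testBit (u : Fin 4 → Bool) (i : Fin 4) : (code u).testBit (4 * i) = u i := by
  revert u i; decide

theorem code_mem (u : Fin 4 → Bool) :
    (code u < 0x1000 → code u ∈ upFrom 0) ∧
    (0x1000 ≤ code u → ∃ q ∈ upFrom 0, code u = q + 0x1000) := by
  revert u; decide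

theorem le_of_mem_upFrom {q : ℕ} (h : q ∈ upFrom 0) : q ≤ 0x111 := by
  revert q; decide

theorem mem_upFrom {m q : ℕ} (h : q ∈ upFrom 0) (hm : m ≤ q) : q ∈ upFrom m := by
  simp only [upFrom, List.mem_filter, Nat.ble_eq] at h ⊢
  exact ⟨h.1, hm⟩

/-- Sorting the colors by their codes brings them into the order of `allResolved`. -/
theorem resolved_of_monotone (hmono : Monotone fun a => code (used a))
    (hcard : ∀ i, (Finset.univ.filter fun a => used a i = true).card = 3) :
    resolved used = true := by
  have hsum : ∑ a, code (used a) = 0x3333 := by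
    simp only [code]
    rw [Finset.sum_comm]
    simp [← Finset.sum_filter, hcard, Fin.sum_univ_four]
  rw [Fin.sum_univ_seven] at hsum
  have m₀ : code (used 0) ≤ code (used 1) := hmono (by decide)
  have m₁ : code (used 1) ≤ code (used 2) := hmono (by decide)
  have m₂ : code (used 2) ≤ code (used 3) := hmono (by decide)
  have m₃ : code (used 3) ≤ code (used 4) := hmono (by decide)
  have m₄ : code (used 4) ≤ code (used 5) := hmono (by decide)
  have m₅ : code (used 5) ≤ code (used 6) := hmono (by decide)
  have hub : ∀ a, code (used a) ≤ 0x1111 := by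
    intro a
    by_cases h : code (used a) < 0x1000
    · have := le_of_mem_upFrom ((code_mem _).1 h); omega
    · obtain ⟨q, hq, hq'⟩ := (code_mem _).2 (not_lt.mp h)
      have := le_of_mem_upFrom hq; omega
  -- The codes add up to `0x3333`: four codes from `0x1000` on are too many, two are too few.
  have l₃ : code (used 3) < 0x1000 := by omega
  have hlow := fun a (h : code (used a) < 0x1000) => (code_mem _).1 h
  have l₄ : 0x1000 ≤ code (used 4) := by
    by_contra h
    have h4 := le_of_mem_upFrom (hlow 4 (not_le.mp h))
    have := hub 5
    have := hub 6
    omega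
  obtain ⟨q₄, hq₄, e₄⟩ := (code_mem (used 4)).2 l₄
  obtain ⟨q₅, hq₅, e₅⟩ := (code_mem (used 5)).2 (l₄.trans m₄)
  obtain ⟨q₆, hq₆, e₆⟩ := (code_mem (used 6)).2 (l₄.trans (m₄.trans m₅))
  have h := allResolved_eq_true
  simp only [allResolved, List.all_eq_true, Bool.or_eq_true, Bool.not_eq_true'] at h
  have h₁ := (h _ (hlow 0 (by omega)) _ (mem_upFrom (hlow 1 (by omega)) m₀)
    _ (mem_upFrom (hlow 2 (by omega)) m₁) _ (mem_upFrom (hlow 3 l₃) m₂)).resolve_left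
      (by rw [Nat.ble_eq_true_of_le (by omega)]; decide)
  have h₂ := (h₁ _ hq₄ _ (mem_upFrom hq₅ (by omega)) _ (mem_upFrom hq₆ (by omega))).resolve_left
      fun h' => Nat.ne_of_beq_eq_false h' (by omega)
  rw [← e₄, ← e₅, ← e₆] at h₂
  refine (congrArg resolved ?_).trans h₂
  funext a i
  rw [← code_testBit (used a) i]
  congr 1
  fin_cases a <;> rfl

/-- Since the properties of `R` do not depend on the names of the colors, the colors may be assumed
to be sorted by their codes. -/
theorem exists_isStarColoring_or_isStuck (hR : PathRelation used R)
    (hcard : ∀ i, (Finset.univ.filter fun a => used a i = true).card = 3) :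
    (∃ c, IsStarColoring used R c) ∨ IsStuck used R := by
  set σ := Tuple.sort fun a => code (used a) with hσ
  have h := exists_or_isStuck_of_resolved (used := fun a => used (σ a))
    (R := fun i j a b => R i j (σ a) (σ b)) ⟨hR.symm, hR.used_of, hR.unique⟩
    (resolved_of_monotone (Tuple.monotone_sort fun a => code (used a)) fun i => by
      rw [← hcard i]
      refine Finset.card_bij (fun a _ => σ a) (by simp) (by simp) fun b hb => ?_
      exact ⟨σ.symm b, by simpa using hb, by simp⟩)
  rcases h with ⟨c, hc₁, hc₂, hc₃⟩ | ⟨e, he, he', i, b, hb, hj, l, hl⟩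
  · exact .inl ⟨fun i => σ (c i), σ.injective.comp hc₁, hc₂, hc₃⟩
  · refine .inr ⟨σ e, he, fun e' hne => ?_, i, σ b, hb, hj, l, fun a ha => ?_⟩
    · simpa using he' (σ.symm e') fun h' => hne (by simp [← h'])
    · simpa using hl (σ.symm a) (by simpa using ha)

/-! ### Paths and cycles in graphs of maximum degree two -/

/-- In a graph of maximum degree two, two paths that leave `u` away from its neighbor `t` follow
each other, so they have the same end if their ends have degree at most one. -/
theorem Walk.IsPath.end_eq_of_degree_le_two {V : Type*} {K : SimpleGraph V}
    (h2 : ∀ {u v₁ v₂ v₃}, K.Adj u v₁ → K.Adj u v₂ → K.Adj u v₃ → v₁ = v₂ ∨ v₁ = v₃ ∨ v₂ = v₃)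
    {t u v w : V} (htu : K.Adj u t) {p : K.Walk u v} {q : K.Walk u w} (hp : p.IsPath)
    (hq : q.IsPath) (hpt : t ∉ p.support) (hqt : t ∉ q.support)
    (hv : ∀ {n₁ n₂}, K.Adj v n₁ → K.Adj v n₂ → n₁ = n₂)
    (hw : ∀ {n₁ n₂}, K.Adj w n₁ → K.Adj w n₂ → n₁ = n₂) : v = w := by
  induction p generalizing t with
  | nil =>
    cases q with
    | nil => rfl
    | cons h q' => exact absurd (hv htu h) fun h' => hqt (by simp [h'])
  | cons h p' ih =>
    cases q with
    | nil => exact absurd (hw htu h) fun h' => hpt (by simp [h'])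
    | cons h' q' =>
      rw [Walk.cons_isPath_iff] at hp hq
      simp only [Walk.support_cons, List.mem_cons, not_or] at hpt hqt
      rcases h2 htu h h' with rfl | rfl | rfl
      · exact absurd p'.start_mem_support hpt.2
      · exact absurd q'.start_mem_support hqt.2
      · exact ih h.symm hp.1 hq.1 hp.2 hq.2 hv

/-- In a graph of maximum degree two, a connected component has at most two vertices of degree at
most one. -/
theorem Reachable.eq_of_degree_le_one {V : Type*} {K : SimpleGraph V}
    (h2 : ∀ {u v₁ v₂ v₃}, K.Adj u v₁ → K.Adj u v₂ → K.Adj u v₃ → v₁ = v₂ ∨ v₁ = v₃ ∨ v₂ = v₃)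
    {u v w : V} (huv : K.Reachable u v) (huw : K.Reachable u w) (hne : u ≠ v) (hne' : u ≠ w)
    (hu : ∀ {n₁ n₂}, K.Adj u n₁ → K.Adj u n₂ → n₁ = n₂)
    (hv : ∀ {n₁ n₂}, K.Adj v n₁ → K.Adj v n₂ → n₁ = n₂)
    (hw : ∀ {n₁ n₂}, K.Adj w n₁ → K.Adj w n₂ → n₁ = n₂) : v = w := by
  obtain ⟨p, hp⟩ := huv.exists_isPath
  obtain ⟨q, hq⟩ := huw.exists_isPath
  cases p with
  | nil => exact absurd rfl hne
  | cons h p' =>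
    cases q with
    | nil => exact absurd rfl hne'
    | cons h' q' =>
      obtain rfl := hu h h'
      rw [Walk.cons_isPath_iff] at hp hq
      exact Walk.IsPath.end_eq_of_degree_le_two h2 h.symm hp.1 hq.1 hp.2 hq.2 hv hw

theorem Reachable.exists_adj {V : Type*} {K : SimpleGraph V} {u v : V} (h : K.Reachable u v)
    (hne : u ≠ v) : ∃ w, K.Adj u w := by
  obtain ⟨p⟩ := h
  cases p with
  | nil => exact absurd rfl hne
  | cons h _ => exact ⟨_, h⟩

/-- Contracting the new pendant edge `x u` maps walks to walks. -/
theorem Reachable.of_sup_edge_of_isolated {V : Type*} {K : SimpleGraph V} {x u v : V}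
    (hx : ∀ w, ¬K.Adj x w) (hv : v ≠ x) (h : (K ⊔ edge x u).Reachable x v) :
    K.Reachable u v := by
  classical
  have key : ∀ {p q : V}, (K ⊔ edge x u).Walk p q →
      K.Reachable (if p = x then u else p) (if q = x then u else q) := by
    intro p q w
    induction w with
    | nil => rfl
    | @cons p r q hpr _ ih =>
      refine Reachable.trans ?_ ih
      rw [sup_adj, edge_adj] at hpr
      rcases hpr with hpr | ⟨⟨rfl, rfl⟩ | ⟨rfl, rfl⟩, -⟩
      · have h₁ : p ≠ x := fun h => hx _ (h ▸ hpr)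
        have h₂ : r ≠ x := fun h => hx _ (h ▸ hpr.symm)
        simpa [h₁, h₂] using hpr.reachable
      · simp
      · simp
  obtain ⟨w⟩ := h
  simpa [hv] using key w

theorem IsAcyclic.sup_edge_sup_edge {V : Type*} {K : SimpleGraph V} (hK : K.IsAcyclic) {x u v : V}
    (hx : ∀ w, ¬K.Adj x w) (hu : u ≠ x) (hv : v ≠ x) (h : ¬K.Reachable u v) :
    (K ⊔ edge x u ⊔ edge x v).IsAcyclic := by
  refine IsAcyclic.sup_edge_of_not_reachable
    (fun h' => h (h'.of_sup_edge_of_isolated hx hv)) ?_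
  exact hK.sup_edge_of_not_reachable fun h' => by
    obtain ⟨w, hw⟩ := h'.exists_adj hu.symm
    exact hx w hw

/-! ### Decompositions into matchings with acyclic unions -/

/-- An acyclic edge coloring of `K` with seven colors, given by its color classes `H a`: they are
matchings, they partition the edges of `K`, and the union of any two of them has no cycle. -/
structure IsAcyclicDecomposition {V : Type*} (K : SimpleGraph V) (H : Fin 7 → SimpleGraph V) :
    Prop where
  adj_iff : ∀ {u v}, K.Adj u v ↔ ∃ a, (H a).Adj u v
  matching : ∀ {a u v w}, (H a).Adj u v → (H a).Adj u w → v = w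
  disjoint : ∀ {a b u v}, (H a).Adj u v → (H b).Adj u v → a = b
  acyclic : ∀ a b, (H a ⊔ H b).IsAcyclic

variable {V : Type*} {K : SimpleGraph V} {H : Fin 7 → SimpleGraph V}

/-- The number of colors at a vertex is at most its degree. -/
theorem IsAcyclicDecomposition.card_le (hH : IsAcyclicDecomposition K H) {v : V} {d : ℕ}
    (hd : ∀ A : Finset V, (∀ w ∈ A, K.Adj v w) → A.card ≤ d) {S : Finset (Fin 7)}
    (hS : ∀ a ∈ S, ∃ w, (H a).Adj v w) : S.card ≤ d := by
  classical
  have : Nonempty V := ⟨v⟩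
  choose! f hf using hS
  rw [← Finset.card_image_of_injOn (f := f)]
  · refine hd _ fun w hw => ?_
    obtain ⟨a, ha, rfl⟩ := Finset.mem_image.mp hw
    exact hH.adj_iff.mpr ⟨a, hf a ha⟩
  · intro a ha b hb hab
    exact hH.disjoint (hf a ha) (by rw [hab]; exact hf b hb)

theorem IsAcyclicDecomposition.sup_eq_or (hH : IsAcyclicDecomposition K H) {a b : Fin 7}
    {u v₁ v₂ v₃ : V} (h₁ : (H a ⊔ H b).Adj u v₁) (h₂ : (H a ⊔ H b).Adj u v₂)
    (h₃ : (H a ⊔ H b).Adj u v₃) : v₁ = v₂ ∨ v₁ = v₃ ∨ v₂ = v₃ := by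
  rw [sup_adj] at h₁ h₂ h₃
  rcases h₁ with h₁ | h₁ <;> rcases h₂ with h₂ | h₂ <;> rcases h₃ with h₃ | h₃ <;>
    first
      | exact .inl (hH.matching h₁ h₂)
      | exact .inr (.inl (hH.matching h₁ h₃))
      | exact .inr (.inr (hH.matching h₂ h₃))

theorem IsAcyclicDecomposition.sup_eq (hH : IsAcyclicDecomposition K H) {a b : Fin 7} {u : V}
    (hu : ∀ w, ¬(H a).Adj u w) {v₁ v₂ : V} (h₁ : (H a ⊔ H b).Adj u v₁)
    (h₂ : (H a ⊔ H b).Adj u v₂) : v₁ = v₂ :=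
  hH.matching (h₁.resolve_left (hu _)) (h₂.resolve_left (hu _))

/-- An acyclic decomposition of `K` together with a numbering `e` of the vertices in `N`, which are
to be joined to a new vertex, by at most four positions, and three colors at each position which
include those at the vertex of that number. Positions without a vertex carry three arbitrary
colors. -/
structure IsStarData (K : SimpleGraph V) (H : Fin 7 → SimpleGraph V) (N : Finset V) (e : V → Fin 4)
    (used : Fin 7 → Fin 4 → Bool) : Prop extends IsAcyclicDecomposition K H where
  injOn : Set.InjOn e N
  used_of_adj : ∀ {v}, v ∈ N → ∀ {a w}, (H a).Adj v w → used a (e v) = true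
  card_used : ∀ i, (Finset.univ.filter fun a => used a i = true).card = 3

/-- The vertices of `N` numbered `i` and `j` are joined by a path in the colors `a` and `b`. -/
def starRel (H : Fin 7 → SimpleGraph V) (N : Finset V) (e : V → Fin 4) (i j : Fin 4)
    (a b : Fin 7) : Prop :=
  ∃ u ∈ N, ∃ v ∈ N, e u = i ∧ e v = j ∧ (H a ⊔ H b).Reachable u v

variable {N : Finset V} {e : V → Fin 4} {used : Fin 7 → Fin 4 → Bool}

theorem IsStarData.not_adj (h : IsStarData K H N e used) {v : V} (hv : v ∈ N) {a : Fin 7}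
    (ha : used a (e v) = false) (w : V) : ¬(H a).Adj v w := fun hw => by
  simp [h.used_of_adj hv hw] at ha

theorem IsStarData.pathRelation (h : IsStarData K H N e used) :
    PathRelation used (starRel H N e) where
  symm := by
    rintro i j a b ⟨u, hu, v, hv, hi, hj, hr⟩
    exact ⟨v, hv, u, hu, hj, hi, by rw [sup_comm]; exact hr.symm⟩
  used_of := by
    rintro i j a b hij ⟨u, hu, v, hv, rfl, rfl, hr⟩ ha
    obtain ⟨w, hw⟩ := hr.exists_adj (fun h => hij (by rw [h]))
    exact h.used_of_adj hu (hw.resolve_left (h.not_adj hu ha w))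
  unique := by
    rintro i j k a b hij hik ha hbj hbk ⟨u, hu, v, hv, rfl, rfl, hr⟩ ⟨u', hu', w, hw, hi, rfl, hr'⟩
    obtain rfl := h.injOn hu' hu hi
    have hend : ∀ {v}, v ∈ N → used b (e v) = false → ∀ {n₁ n₂}, (H a ⊔ H b).Adj v n₁ →
        (H a ⊔ H b).Adj v n₂ → n₁ = n₂ := by
      intro v hv hb n₁ n₂ h₁ h₂
      rw [sup_comm] at h₁ h₂
      exact h.sup_eq (h.not_adj hv hb) h₁ h₂
    exact congrArg e (hr.eq_of_degree_le_one h.sup_eq_or hr' (fun h => hij (by rw [h]))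
      (fun h => hik (by rw [h])) (h.sup_eq (h.not_adj hu ha)) (hend hv hbj) (hend hw hbk))

/-- The edges from `x` to the vertices of `N` that get the color `a`. -/
def colorStar (x : V) (N : Finset V) (e : V → Fin 4) (c : Fin 4 → Fin 7) (a : Fin 7) :
    SimpleGraph V :=
  fromRel fun p q => p = x ∧ q ∈ N ∧ c (e q) = a

/-- The edges from a new vertex `x` to the vertices of `N` can be given the colors of a star
coloring: two color classes gain at most two edges, which join `x` to vertices in different
components. -/
theorem IsStarData.exists_extension (h : IsStarData K H N e used) {x : V} (hx : ∀ w, ¬K.Adj x w)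
    (hxN : x ∉ N) {c : Fin 4 → Fin 7} (hc : IsStarColoring used (starRel H N e) c)
    {K' : SimpleGraph V}
    (hK' : ∀ p q, K'.Adj p q ↔ K.Adj p q ∨ p = x ∧ q ∈ N ∨ q = x ∧ p ∈ N) :
    ∃ H', IsAcyclicDecomposition K' H' := by
  obtain ⟨hinj, hunused, hrel⟩ := hc
  have hne : ∀ {v}, v ∈ N → v ≠ x := fun hv h => hxN (h ▸ hv)
  have hxH : ∀ a w, ¬(H a).Adj x w := fun a w hw => hx w (h.adj_iff.mpr ⟨a, hw⟩)
  have hadj : ∀ {a p q}, (H a ⊔ colorStar x N e c a).Adj p q ↔ (H a).Adj p q ∨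
      p = x ∧ q ∈ N ∧ c (e q) = a ∨ q = x ∧ p ∈ N ∧ c (e p) = a := by
    intro a p q
    rw [sup_adj, colorStar, fromRel_adj]
    refine or_congr Iff.rfl ⟨fun h => h.2, fun h => ⟨?_, h⟩⟩
    rintro rfl
    rcases h with ⟨rfl, h, -⟩ | ⟨rfl, h, -⟩ <;> exact hxN h
  have hsame : ∀ {u v}, u ∈ N → v ∈ N → c (e u) = c (e v) → u = v := fun hu hv huv =>
    h.injOn hu hv (hinj huv)
  -- Each color class gains at most one edge.
  have hstar : ∀ a, (H a ⊔ colorStar x N e c a ≤ H a) ∨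
      ∃ u ∈ N, c (e u) = a ∧ H a ⊔ colorStar x N e c a ≤ H a ⊔ edge x u := by
    intro a
    by_cases hu : ∃ u ∈ N, c (e u) = a
    · obtain ⟨u, hu, rfl⟩ := hu
      refine .inr ⟨u, hu, rfl, fun p q hpq => ?_⟩
      rw [sup_adj, edge_adj]
      rcases hadj.mp hpq with hpq | ⟨rfl, hq, hqu⟩ | ⟨rfl, hp, hpu⟩
      · exact .inl hpq
      · obtain rfl := hsame hq hu hqu
        exact .inr ⟨.inl ⟨rfl, rfl⟩, (hne hq).symm⟩
      · obtain rfl := hsame hp hu hpu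
        exact .inr ⟨.inr ⟨rfl, rfl⟩, hne hp⟩
    · refine .inl fun p q hpq => ?_
      rcases hadj.mp hpq with hpq | ⟨-, hq⟩ | ⟨-, hp⟩
      · exact hpq
      · exact absurd ⟨q, hq⟩ hu
      · exact absurd ⟨p, hp⟩ hu
  refine ⟨fun a => H a ⊔ colorStar x N e c a, ⟨?_, ?_, ?_, ?_⟩⟩
  · intro p q
    rw [hK', h.adj_iff]
    simp only [hadj]
    grind
  · intro a p v w hv hw
    rcases hadj.mp hv with hv | ⟨rfl, hv, hva⟩ | ⟨rfl, hp, hpa⟩ <;>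
      rcases hadj.mp hw with hw | ⟨hpx, hw, hwa⟩ | ⟨hwx, hp', hpa'⟩
    · exact h.matching hv hw
    · exact absurd (hpx ▸ hv) (hxH _ _)
    · exact absurd hv (h.not_adj hp' (hpa' ▸ hunused _) _)
    · exact absurd hw (hxH _ _)
    · exact hsame hv hw (hva.trans hwa.symm)
    · exact absurd hp' hxN
    · exact absurd hw (h.not_adj hp (hpa ▸ hunused _) _)
    · exact absurd hpx (hne hp)
    · exact hwx.symm
  · intro a b p q hv hw
    rcases hadj.mp hv with hv | ⟨rfl, hv, hva⟩ | ⟨rfl, hp, hpa⟩ <;>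
      rcases hadj.mp hw with hw | ⟨hpx, hw, hwa⟩ | ⟨hwx, hp', hpa'⟩
    · exact h.disjoint hv hw
    · exact absurd (hpx ▸ hv) (hxH _ _)
    · exact absurd (hwx ▸ hv.symm) (hxH _ _)
    · exact absurd hw (hxH _ _)
    · exact hva.symm.trans hwa
    · exact absurd hp' hxN
    · exact absurd hw.symm (hxH _ _)
    · exact absurd hpx (hne hp)
    · exact hpa.symm.trans hpa'
  · intro a b
    have hx' : ∀ w, ¬(H a ⊔ H b).Adj x w := fun w hw => hw.elim (hxH _ _) (hxH _ _)
    have hone : ∀ {u}, u ∈ N → ((H a ⊔ H b) ⊔ edge x u).IsAcyclic := fun hu =>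
      (h.acyclic a b).sup_edge_of_not_reachable fun h' => by
        obtain ⟨w, hw⟩ := h'.exists_adj (hne hu).symm
        exact hx' w hw
    rcases hstar a with ha | ⟨u, hu, hua, ha⟩ <;> rcases hstar b with hb | ⟨v, hv, hvb, hb⟩
    · exact (h.acyclic a b).anti (sup_le_sup ha hb)
    · exact (hone hv).anti ((sup_le_sup ha hb).trans (by rw [sup_assoc]))
    · exact (hone hu).anti ((sup_le_sup ha hb).trans (by rw [sup_right_comm]))
    · by_cases huv : u = v
      · subst huv
        refine (hone hu).anti ((sup_le_sup ha hb).trans ?_)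
        rw [← sup_sup_distrib_right]
      · have hnr : ¬(H a ⊔ H b).Reachable u v := fun hr =>
          hrel (e u) (e v) (fun he => huv (h.injOn hu hv he))
            ⟨u, hu, v, hv, rfl, rfl, by rw [hua, hvb]; exact hr⟩
        refine ((h.acyclic a b).sup_edge_sup_edge hx' (hne hu) (hne hv) hnr).anti
          ((sup_le_sup ha hb).trans ?_)
        rw [sup_sup_sup_comm, sup_assoc (H a ⊔ H b)]

/-! ### Recoloring an edge -/

/-- A bichromatic path from `u`, missing `a`, to `v`, missing `b`, has at least two edges: after the
first one, of color `b`, it goes on in the color `a`. -/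
theorem IsStarData.exists_adj_adj (h : IsStarData K H N e used) {u v : V} (hu : u ∈ N) (hv : v ∈ N)
    (huv : u ≠ v) {a b : Fin 7} (ha : used a (e u) = false) (hb : used b (e v) = false)
    (hr : (H a ⊔ H b).Reachable u v) : ∃ z, (H b).Adj u z ∧ ∃ t, (H a).Adj z t := by
  obtain ⟨p, hp⟩ := hr.exists_isPath
  cases p with
  | nil => exact absurd rfl huv
  | @cons _ z _ huz p =>
    have huz' := huz.resolve_left (h.not_adj hu ha _)
    refine ⟨z, huz', ?_⟩
    cases p with
    | nil => exact absurd huz'.symm (h.not_adj hv hb _)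
    | @cons _ t _ hzt p =>
      refine ⟨t, hzt.resolve_right fun hzt' => ?_⟩
      obtain rfl := h.matching huz'.symm hzt'
      simp [Walk.cons_isPath_iff] at hp

/-- An edge `u z` of color `b` can be recolored to `f` if `f` is free at both ends and every color
other than `b` is free at one of the ends. -/
theorem IsAcyclicDecomposition.recolor (hH : IsAcyclicDecomposition K H) {b f : Fin 7} {u z : V}
    (hbf : b ≠ f) (huz : (H b).Adj u z)
    (hiso : ∀ a, a ≠ b → (∀ w, ¬(H a ⊔ H f).Adj u w) ∨ ∀ w, ¬(H a ⊔ H f).Adj z w)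
    (hu : ∀ w, ¬(H f).Adj u w) (hz : ∀ w, ¬(H f).Adj z w) :
    ∃ H', IsAcyclicDecomposition K H' ∧ ∀ a p q, (H' a).Adj p q ↔
      (H a).Adj p q ∧ s(p, q) ≠ s(u, z) ∨ a = f ∧ s(p, q) = s(u, z) := by
  classical
  let H' : Fin 7 → SimpleGraph V := fun a =>
    (H a).deleteEdges {s(u, z)} ⊔ if a = f then edge u z else ⊥
  have hadj : ∀ a p q, (H' a).Adj p q ↔
      (H a).Adj p q ∧ s(p, q) ≠ s(u, z) ∨ a = f ∧ s(p, q) = s(u, z) := by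
    intro a p q
    simp only [H', sup_adj, deleteEdges_adj, Set.mem_singleton_iff]
    refine or_congr Iff.rfl ?_
    by_cases ha : a = f
    · rw [if_pos ha, adj_edge]
      refine ⟨fun h => ⟨ha, h.1.symm⟩, fun h => ⟨h.2.symm, ?_⟩⟩
      rintro rfl
      have := h.2
      have := huz.ne
      grind
    · simp [ha]
  have hle : ∀ a, a ≠ f → H' a ≤ H a := fun a ha p q hpq =>
    (((hadj a p q).mp hpq).resolve_right fun h => ha h.1).1
  have hlef : H' f ≤ H f ⊔ edge u z := sup_le_sup (deleteEdges_le _) (by simp)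
  have hb : edge u z ≤ H b := by
    intro p q hpq
    rw [edge_adj] at hpq
    rcases hpq.1 with ⟨rfl, rfl⟩ | ⟨rfl, rfl⟩
    exacts [huz, huz.symm]
  -- The class of `f` gains the edge `u z`. Together with the class of `b` this edge is not new, and
  -- together with any other class it joins an isolated vertex.
  have hf : ∀ a, (H' a ⊔ H' f).IsAcyclic := by
    have hfb : H' f ≤ H b ⊔ H f := hlef.trans (sup_le le_sup_right (hb.trans le_sup_left))
    intro a
    by_cases hab : a = b
    · subst hab
      exact (hH.acyclic a f).anti (sup_le ((hle a hbf).trans le_sup_left) hfb)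
    by_cases haf : a = f
    · subst haf
      exact (hH.acyclic b a).anti (sup_le hfb hfb)
    · refine IsAcyclic.anti (G' := H a ⊔ H f ⊔ edge u z)
        ((sup_le_sup (hle a haf) hlef).trans (sup_assoc _ _ _).ge)
        ((hH.acyclic a f).sup_edge_of_not_reachable fun hr => ?_)
      rcases hiso a hab with h | h
      · obtain ⟨w, hw⟩ := hr.exists_adj huz.ne
        exact h w hw
      · obtain ⟨w, hw⟩ := hr.symm.exists_adj huz.ne'
        exact h w hw
  refine ⟨H', ⟨?_, ?_, ?_, ?_⟩, hadj⟩
  · intro p q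
    simp only [hadj, hH.adj_iff]
    constructor
    · rintro ⟨a, ha⟩
      by_cases hs : s(p, q) = s(u, z)
      · exact ⟨f, .inr ⟨rfl, hs⟩⟩
      · exact ⟨a, .inl ⟨ha, hs⟩⟩
    · rintro ⟨a, ⟨ha, -⟩ | ⟨-, hs⟩⟩
      · exact ⟨a, ha⟩
      · refine ⟨b, ?_⟩
        rw [← mem_edgeSet, hs]
        exact huz
  · intro a p v w hv hw
    rw [hadj] at hv hw
    have hends : ∀ {v w}, s(p, v) = s(u, z) → ¬(H f).Adj p w := by
      intro v w hs
      rcases Sym2.eq_iff.mp hs with ⟨rfl, -⟩ | ⟨rfl, -⟩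
      exacts [hu w, hz w]
    rcases hv with ⟨hv, -⟩ | ⟨rfl, hv⟩ <;> rcases hw with ⟨hw, -⟩ | ⟨haf, hw⟩
    · exact hH.matching hv hw
    · exact absurd (haf ▸ hv) (hends hw)
    · exact absurd hw (hends hv)
    · exact Sym2.congr_right.mp (hv.trans hw.symm)
  · intro a c p q hv hw
    rw [hadj] at hv hw
    rcases hv with ⟨hv, hv'⟩ | ⟨rfl, hv⟩ <;> rcases hw with ⟨hw, hw'⟩ | ⟨hcf, hw⟩
    · exact hH.disjoint hv hw
    · exact absurd hw hv'
    · exact absurd hv hw'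
    · exact hcf.symm
  · intro a c
    by_cases haf : a = f
    · subst haf
      rw [sup_comm]
      exact hf c
    by_cases hcf : c = f
    · subst hcf
      exact hf a
    · exact (hH.acyclic a c).anti (sup_le_sup (hle a haf) (hle c hcf))

/-- Replacing the taken color `b` by the free color `f` keeps the number of taken colors. -/
theorem card_filter_swap {used : Fin 7 → Fin 4 → Bool} {b f : Fin 7} {i : Fin 4}
    (hb : used b i = true) (hf : used f i = false) :
    (Finset.univ.filter fun a =>
        (if a = b then false else if a = f then true else used a i) = true).card
      = (Finset.univ.filter fun a => used a i = true).card := by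
  have hbf : b ≠ f := by rintro rfl; simp [hb] at hf
  refine Finset.card_bij (fun a _ => Equiv.swap b f a) ?_ ?_ ?_
  · intro a ha
    simp only [Finset.mem_filter, Finset.mem_univ, true_and] at ha ⊢
    by_cases hab : a = b
    · simp [hab] at ha
    by_cases haf : a = f
    · simp [haf, hb]
    · rw [Equiv.swap_apply_of_ne_of_ne hab haf]
      simpa [hab, haf] using ha
  · intro a _ c _ h
    exact (Equiv.swap b f).injective h
  · intro a ha
    refine ⟨Equiv.swap b f a, ?_, by simp⟩
    simp only [Finset.mem_filter, Finset.mem_univ, true_and] at ha ⊢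
    by_cases hab : a = b
    · simp [hab, hbf.symm]
    by_cases haf : a = f
    · simp [haf, hf] at ha
    · simp [Equiv.swap_apply_of_ne_of_ne hab haf, hab, haf, ha]

/-- After recoloring at most one edge, the new star can be colored. -/
theorem IsStarData.exists_isStarColoring (h : IsStarData K H N e used)
    (hdeg : ∀ v, ∀ A : Finset V, (∀ w ∈ A, K.Adj v w) → A.card ≤ 4)
    (hdegN : ∀ v ∈ N, ∀ A : Finset V, (∀ w ∈ A, K.Adj v w) → A.card ≤ 3) :
    ∃ H' used' c, IsStarData K H' N e used' ∧ IsStarColoring used' (starRel H' N e) c := by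
  classical
  rcases exists_isStarColoring_or_isStuck h.pathRelation h.card_used with ⟨c, hc⟩ | hstuck
  · exact ⟨H, used, c, h, hc⟩
  obtain ⟨f, hf, hf', i, b, hb, ⟨j, hji, hbj⟩, l, hl⟩ := hstuck
  have hbf : b ≠ f := by rintro rfl; simp [hf] at hb
  have hbl : used b l = false := by
    by_contra hbl
    simp [(hl b (by simpa using hbl)).1] at hb
  have hpath : ∀ a, used a l = true →
      ∃ u ∈ N, e u = i ∧ ∃ z, (H b).Adj u z ∧ ∃ t, (H a).Adj z t := by
    intro a ha
    obtain ⟨hai, j, hij, hbj, u, hu, v, hv, rfl, rfl, hr⟩ := hl a ha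
    exact ⟨u, hu, rfl, h.exists_adj_adj hu hv (fun h' => hij (by rw [h'])) hai hbj hr⟩
  obtain ⟨a₀, ha₀⟩ : ∃ a, used a l = true := by
    have := h.card_used l
    obtain ⟨a, ha⟩ := Finset.card_pos.mp (by omega :
      0 < (Finset.univ.filter fun a => used a l = true).card)
    exact ⟨a, by simpa using ha⟩
  obtain ⟨u, hu, rfl, z, huz, -⟩ := hpath a₀ ha₀
  have hzl : ∀ a, used a l = true → ∃ t, (H a).Adj z t := by
    intro a ha
    obtain ⟨u', hu', hi, z', huz', ht⟩ := hpath a ha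
    obtain rfl := h.injOn hu' hu hi
    obtain rfl := h.matching huz huz'
    exact ht
  -- The colors at `z` are exactly those in `S`, as `z` has degree at most four.
  set S := insert b (Finset.univ.filter fun a => used a l = true) with hS
  have hScard : S.card = 4 := by
    rw [hS, Finset.card_insert_of_notMem (by simp [hbl]), h.card_used]
  have hSz : ∀ a ∈ S, ∃ t, (H a).Adj z t := by
    intro a ha
    rcases Finset.mem_insert.mp ha with rfl | ha
    · exact ⟨u, huz.symm⟩
    · exact hzl a (by simpa using ha)
  have hzS : ∀ a, a ≠ b → used a l = false → ∀ t, ¬(H a).Adj z t := by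
    intro a hab hal t hat
    have := h.card_le (hdeg z) (S := insert a S) fun c hc => by
      rcases Finset.mem_insert.mp hc with rfl | hc
      · exact ⟨t, hat⟩
      · exact hSz c hc
    rw [Finset.card_insert_of_notMem (by simp [S, hab, hal])] at this
    omega
  -- A vertex of `N` has degree at most three, so the new color at `z` does not matter for the star.
  have hzN : z ∉ N := fun hz => by
    have := h.card_le (hdegN z hz) hSz
    omega
  have hfu := h.not_adj hu (hf (e u))
  have hfz := hzS f hbf.symm (hf l)
  obtain ⟨H', hH', hadj⟩ := h.recolor hbf huz (fun a hab => by
    by_cases hau : used a (e u) = true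
    · refine .inr fun w hw => hw.elim (hzS a hab ?_ w) (hfz w)
      by_contra hal
      simp [(hl a (by simpa using hal)).1] at hau
    · exact .inl fun w hw => hw.elim (h.not_adj hu (by simpa using hau) w) (hfu w)) hfu hfz
  set used' : Fin 7 → Fin 4 → Bool := fun a i =>
    if i = e u then (if a = b then false else if a = f then true else used a i) else used a i
    with hused'
  have hdata : IsStarData K H' N e used' := by
    refine ⟨hH', h.injOn, ?_, fun i => ?_⟩
    · intro v hv a w hvw
      rcases (hadj _ _ _).mp hvw with ⟨hvw, hne⟩ | ⟨rfl, hs⟩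
      · have hva := h.used_of_adj hv hvw
        by_cases hvu : e v = e u
        · obtain rfl := h.injOn hv hu hvu
          have hab : a ≠ b := by
            rintro rfl
            exact hne (by rw [h.matching hvw huz])
          simp [hused', hab, hva]
        · simpa [hused', hvu] using hva
      · rcases Sym2.eq_iff.mp hs with ⟨rfl, -⟩ | ⟨rfl, -⟩
        · simp [hused', hbf.symm]
        · exact absurd hv hzN
    · by_cases hi : i = e u
      · subst hi
        simp only [hused', if_true]
        exact (card_filter_swap hb (hf _)).trans (h.card_used _)
      · simpa [hused', hi] using h.card_used i
  rcases exists_isStarColoring_or_isStuck hdata.pathRelation hdata.card_used with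
    ⟨c, hc⟩ | ⟨g, hg, -⟩
  · exact ⟨H', used', c, hdata, hc⟩
  · -- No color is free at all positions: `b` is still taken at `j`, and `f` is now taken at `e u`.
    exfalso
    by_cases hgb : g = b
    · have := hg j
      simp [hused', hji, hgb, hbj] at this
    by_cases hgf : g = f
    · have := hg (e u)
      simp [hused', hgf, hbf.symm] at this
    · obtain ⟨k, hk⟩ := hf' g hgf
      have := hg k
      simp [hused', hgb, hgf, hk] at this

theorem IsAcyclicDecomposition.exists_isStarData (hH : IsAcyclicDecomposition K H)
    (hN : N.card ≤ 4) (hdegN : ∀ v ∈ N, ∀ A : Finset V, (∀ w ∈ A, K.Adj v w) → A.card ≤ 3) :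
    ∃ e used, IsStarData K H N e used := by
  classical
  obtain ⟨e, he⟩ : ∃ e : V → Fin 4, Set.InjOn e N := by
    obtain ⟨g⟩ := Function.Embedding.nonempty_of_card_le (α := N) (β := Fin 4) (by simpa using hN)
    refine ⟨fun v => if hv : v ∈ N then g ⟨v, hv⟩ else 0, fun u hu v hv huv => ?_⟩
    have hu' : u ∈ N := hu
    have hv' : v ∈ N := hv
    simpa [hu', hv'] using huv
  have hT : ∀ i, ∃ T : Finset (Fin 7), T.card = 3 ∧
      ∀ v ∈ N, e v = i → ∀ a w, (H a).Adj v w → a ∈ T := by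
    intro i
    set S : Finset (Fin 7) := Finset.univ.filter fun a => ∃ v ∈ N, e v = i ∧ ∃ w, (H a).Adj v w
      with hS
    have hS3 : S.card ≤ 3 := by
      by_cases hi : ∃ v ∈ N, e v = i
      · obtain ⟨v, hv, rfl⟩ := hi
        refine hH.card_le (hdegN v hv) fun a ha => ?_
        obtain ⟨v', hv', hvv', hw⟩ := (Finset.mem_filter.mp ha).2
        rwa [he hv' hv hvv'] at hw
      · rw [Finset.card_eq_zero.mpr]
        · omega
        · refine Finset.filter_eq_empty_iff.mpr fun a _ ⟨v, hv, hvi, _⟩ => hi ⟨v, hv, hvi⟩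
    obtain ⟨T, hST, -, hT⟩ := Finset.exists_subsuperset_card_eq (Finset.subset_univ S) hS3
      (by simp)
    exact ⟨T, hT, fun v hv hvi a w hw => hST (by simpa [hS] using ⟨v, hv, hvi, w, hw⟩)⟩
  choose T hT3 hT using hT
  exact ⟨e, fun a i => decide (a ∈ T i), hH, he,
    fun {v} hv {a w} hw => by simpa using hT _ v hv rfl a w hw, fun i => by simpa using hT3 i⟩

/-! ### Coloring vertex by vertex -/

/-- The subgraphs induced on finite sets of vertices are colored by adding one vertex at a time. -/
theorem exists_isAcyclicDecomposition_of_card_le {G : SimpleGraph V}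
    (hdeg : ∀ v, ∀ A : Finset V, (∀ w ∈ A, G.Adj v w) → A.card ≤ 4) (s : Finset V) :
    ∃ H, IsAcyclicDecomposition (G.induce (s : Set V)).spanningCoe H := by
  classical
  have hadj : ∀ (s : Finset V) u v,
      (G.induce (s : Set V)).spanningCoe.Adj u v ↔ G.Adj u v ∧ u ∈ s ∧ v ∈ s := by
    intro s u v
    simp
  induction s using Finset.induction_on with
  | empty =>
    refine ⟨fun _ => ⊥, ⟨?_, ?_, ?_, ?_⟩⟩
    · intro u v
      simp
    · intro a u v w h
      exact h.elim
    · intro a b u v h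
      exact h.elim
    · simp
  | insert x s hxs ih =>
    obtain ⟨H, hH⟩ := ih
    set N := s.filter fun v => G.Adj x v with hN
    have hdegN : ∀ v ∈ N, ∀ A : Finset V,
        (∀ w ∈ A, (G.induce (s : Set V)).spanningCoe.Adj v w) → A.card ≤ 3 := by
      intro v hv A hA
      have hxA : x ∉ A := fun hx => hxs ((hadj _ _ _).mp (hA x hx)).2.2
      have := hdeg v (insert x A) fun w hw => by
        rcases Finset.mem_insert.mp hw with rfl | hw
        · exact (Finset.mem_filter.mp hv).2.symm
        · exact ((hadj _ _ _).mp (hA w hw)).1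
      rw [Finset.card_insert_of_notMem hxA] at this
      omega
    obtain ⟨e, used, h⟩ := hH.exists_isStarData
      (hdeg x N fun w hw => (Finset.mem_filter.mp hw).2) hdegN
    obtain ⟨H', used', c, h', hc⟩ := h.exists_isStarColoring
      (fun v A hA => hdeg v A fun w hw => ((hadj _ _ _).mp (hA w hw)).1) hdegN
    refine h'.exists_extension (x := x) (fun w hw => hxs ((hadj _ _ _).mp hw).2.1)
      (fun hx => hxs (Finset.mem_filter.mp hx).1) hc fun p q => ?_
    rw [hadj, hadj]
    simp only [hN, Finset.mem_filter, Finset.mem_insert]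
    have := G.adj_comm p q
    have := G.ne_of_adj (a := p) (b := q)
    grind

theorem IsAcyclicDecomposition.acyclicallyEdgeColorable (hH : IsAcyclicDecomposition K H) :
    K.AcyclicallyEdgeColorable 7 := by
  have hex : ∀ f : K.edgeSet, ∃ a, f.1 ∈ (H a).edgeSet := by
    rintro ⟨f, hf⟩
    induction f using Sym2.ind with
    | _ u v => exact hH.adj_iff.mp hf
  choose c hc using hex
  refine ⟨c, ?_, fun a b => (hH.acyclic a b).anti (sup_le_sup ?_ ?_)⟩
  · rintro ⟨f, hf⟩ ⟨g, hg⟩ hfg heq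
    obtain ⟨hne, v, hvf, hvg⟩ := lineGraph_adj_iff_exists.mp hfg
    obtain ⟨u, rfl⟩ := Sym2.mem_iff_exists.mp hvf
    obtain ⟨w, rfl⟩ := Sym2.mem_iff_exists.mp hvg
    have h₁ := hc ⟨_, hf⟩
    have h₂ := hc ⟨_, hg⟩
    rw [heq] at h₁
    obtain rfl : u = w := hH.matching h₁ h₂
    exact hne rfl
  all_goals
    intro u v huv
    obtain ⟨h, rfl⟩ := (EdgeLabeling.labelGraph_adj _ _).mp huv
    exact hc ⟨s(u, v), h⟩

end SimpleGraph

theorem corollary1 {V : Type*} [Fintype V] (G : SimpleGraph V) [DecidableRel G.Adj]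
    (hG : G.maxDegree ≤ 4) : G.acyclicChromaticIndex ≤ 7 := by
  have hdeg : ∀ v, ∀ A : Finset V, (∀ w ∈ A, G.Adj v w) → A.card ≤ 4 := fun v A hA =>
    (Finset.card_le_card fun w hw => (G.mem_neighborFinset v w).mpr (hA w hw)).trans
      ((G.degree_le_maxDegree v).trans hG)
  obtain ⟨H, hH⟩ := SimpleGraph.exists_isAcyclicDecomposition_of_card_le hdeg Finset.univ
  have hcol : G.AcyclicallyEdgeColorable 7 := by
    have := hH.acyclicallyEdgeColorable
    rwa [show (G.induce ((Finset.univ : Finset V) : Set V)).spanningCoe = G by ext; simp] at this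
  exact iInf₂_le 7 hcol
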